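/- Let $N\in\mathbb N$, let $(\Omega,\mathcal F,\mathbb P)$ be a probability space and let $(\tau_x)_{x\in\mathbb R^N}$ be an $N$-dimensional dynamical system on it, i.e. a family of maps $\tau_x:\Omega\to\Omega$ with $\tau_0=\mathrm{id}$, $\tau_{x+y}=\tau_x\circ\tau_y$, each $\tau_x$ measurable and $\mathbb P$-preserving, and $(x,\omega)\mapsto\tau_x\omega$ jointly measurable. For $\kappa>0$, a $\kappa$-Lipschitz random function is a random variable $\omega\mapsto v(\cdot,\omega)$ with values in the space of $\kappa$-Lipschitz functions $\mathbb R^N\to\mathbb R$, equipped with the topology of uniform convergence on compact sets and its Borel $\sigma$-algebra; a Lipschitz random function is a $\kappa$-Lipschitz random function for some $\kappa>0$. It has stationary increments if for every $z\in\mathbb R^N$ there is a set $\Omega_z$ of probability $1$ such that, for all $\omega\in\Omega_z$ and all $x,y\in\mathbb R^N$, \[ v(x+z,\omega)-v(y+z,\omega)=v(x,\tau_z\omega)-v(y,\tau_z\omega). \] Let $(v_n)_{n\in\mathbb N}$ be a sequence of random functions with stationary increments which is equiLipschitz, i.e. there is $\kappa>0$ such that every $v_n$ is a $\kappa$-Lipschitz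 random function. Then there exist a Lipschitz random function $v$ with stationary increments, a sequence of indices $n_k\to\infty$, finite convex combinations \[ w_k=\sum_{n\ge n_k}\lambda^k_n v_n \qquad \Bigl(\lambda_n^k\ge 0,\ \lambda^k_n\neq 0 \text{ for only finitely many } n,\ \sum_{n\ge n_k}\lambda^k_n=1\Bigr), \] and real random variables $g_k$ on $\Omega$ such that, for almost every $\omega$, $w_k(\cdot,\omega)+g_k(\omega)\to v(\cdot,\omega)$ uniformly on every compact subset of $\mathbb R^N$ as $k\to\infty$. -/

import Mathlib

open MeasureTheory Filter Topology

/-- An `N`-dimensional dynamical system `(τ_x)`, `x ∈ ℝ^N`, on the probability space `(Ω, P)`: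
a jointly measurable group action by measure preserving maps. -/
structure IsDynamicalSystem {N : ℕ} {Ω : Type*} [MeasurableSpace Ω] (P : Measure Ω)
    (τ : EuclideanSpace ℝ (Fin N) → Ω → Ω) : Prop where
  map_zero : τ 0 = id
  map_add : ∀ x y, τ (x + y) = τ x ∘ τ y
  measurePreserving : ∀ x, MeasurePreserving (τ x) P P
  measurable_joint : Measurable (fun p : EuclideanSpace ℝ (Fin N) × Ω => τ p.1 p.2)

/-- A `κ`-Lipschitz random function: a random variable with values in the space of `κ`-Lipschitz
real functions on `ℝ^N`, with the topology of uniform convergence on compact sets (the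
compact-open topology carried by `C(ℝ^N, ℝ)`) and its Borel `σ`-algebra. -/
def IsLipschitzRandomFunctionWith {N : ℕ} {Ω : Type*} [MeasurableSpace Ω] (κ : NNReal)
    (v : Ω → C(EuclideanSpace ℝ (Fin N), ℝ)) : Prop :=
  Measurable[_, borel C(EuclideanSpace ℝ (Fin N), ℝ)] v ∧ ∀ ω, LipschitzWith κ (v ω)

/-- A Lipschitz random function: a `κ`-Lipschitz random function for some (deterministic)
`κ > 0`. -/
def IsLipschitzRandomFunction {N : ℕ} {Ω : Type*} [MeasurableSpace Ω]
    (v : Ω → C(EuclideanSpace ℝ (Fin N), ℝ)) : Prop :=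
  ∃ κ : NNReal, 0 < κ ∧ IsLipschitzRandomFunctionWith κ v

/-- Stationary increments: for every `z` there is a set of probability `1` (depending on `z`, but
not on `x, y`) on which `v(x + z, ω) - v(y + z, ω) = v(x, τ_z ω) - v(y, τ_z ω)` for all `x, y`. -/
def HasStationaryIncrements {N : ℕ} {Ω : Type*} [MeasurableSpace Ω] (P : Measure Ω)
    (τ : EuclideanSpace ℝ (Fin N) → Ω → Ω)
    (v : Ω → C(EuclideanSpace ℝ (Fin N), ℝ)) : Prop :=
  ∀ z : EuclideanSpace ℝ (Fin N), ∀ᵐ ω ∂P, ∀ x y : EuclideanSpace ℝ (Fin N),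
    v ω (x + z) - v ω (y + z) = v (τ z ω) x - v (τ z ω) y

/-! Normalised to vanish at the origin, the functions grow at most linearly, so suitably weighted
they form a bounded sequence in `L²` of Ω times a countable dense set. A Komlós/Mazur argument gives
forward convex combinations converging in `L²`, and a.e. along a subsequence. The common Lipschitz
bound upgrades this to locally uniform convergence. Increments ignore the normalising constants, so
their stationarity is linear and survives the limit. -/

/-- A map into `C(X, ℝ)` all of whose evaluations are measurable is measurable for the Borel
`σ`-algebra of the compact-open topology. -/
theorem measurable_borel_continuousMap_of_eval {X Ω : Type*} [MetricSpace X]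
    [SecondCountableTopology X] [LocallyCompactSpace X] [MeasurableSpace Ω] {u : Ω → C(X, ℝ)}
    (hu : ∀ x, Measurable fun ω => u ω x) : Measurable[_, borel C(X, ℝ)] u := by
  rw [borel_eq_generateFrom_of_subbasis (ContinuousMap.compactOpen_eq (X := X) (Y := ℝ))]
  refine measurable_generateFrom ?_
  rintro _ ⟨K, hK, U, hU, rfl⟩
  obtain ⟨s, hsc, hsd⟩ := TopologicalSpace.exists_countable_dense K
  have hF (n : ℕ) : IsClosed {y : ℝ | (n : ENNReal)⁻¹ ≤ Metric.infEDist y Uᶜ} :=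
    isClosed_le continuous_const Metric.continuous_infEDist
  -- The compact image of `K` lies at positive distance from `Uᶜ`; by continuity a lower bound on
  -- this distance need only be checked on a countable dense set.
  have key : u ⁻¹' {f | Set.MapsTo f K U} =
      ⋃ n : ℕ, ⋂ x ∈ s, (fun ω => u ω (x : X)) ⁻¹'
        {y : ℝ | (n : ENNReal)⁻¹ ≤ Metric.infEDist y Uᶜ} := by
    ext ω
    simp only [Set.mem_preimage, Set.mem_ofPred_eq, Set.mem_iUnion, Set.mem_iInter]
    constructor
    · intro h
      obtain ⟨δ, hδ, hsub⟩ := (hK.image (u ω).continuous).exists_thickening_subset_open hU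
        (Set.image_subset_iff.2 h)
      obtain ⟨n, hn⟩ := ENNReal.exists_inv_nat_lt (ENNReal.ofReal_pos.2 hδ).ne'
      refine ⟨n, fun x _ => hn.le.trans (Metric.le_infEDist.2 fun z hz => ?_)⟩
      by_contra! hlt
      refine hz (hsub ((Metric.mem_thickening_iff_exists_edist_lt _ _).2
        ⟨u ω x, Set.mem_image_of_mem _ x.2, ?_⟩))
      rwa [edist_comm]
    · rintro ⟨n, hn⟩ x hx
      have hcl : IsClosed {x : K | (n : ENNReal)⁻¹ ≤ Metric.infEDist (u ω x) Uᶜ} :=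
        (hF n).preimage ((u ω).continuous.comp continuous_subtype_val)
      have hall : (⟨x, hx⟩ : K) ∈ {x : K | (n : ENNReal)⁻¹ ≤ Metric.infEDist (u ω x) Uᶜ} :=
        hcl.closure_subset_iff.2 (fun y hy => hn y hy) (hsd.closure_eq ▸ Set.mem_univ _)
      by_contra hxU
      have h0 : Metric.infEDist (u ω x) Uᶜ = 0 := Metric.infEDist_zero_of_mem hxU
      have hle : (n : ENNReal)⁻¹ ≤ Metric.infEDist (u ω x) Uᶜ := hall
      rw [h0, nonpos_iff_eq_zero, ENNReal.inv_eq_zero] at hle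
      exact ENNReal.natCast_ne_top n hle
  rw [key]
  exact .iUnion fun n => .biInter hsc fun x _ => hu x (hF n).measurableSet

/-- Weights of finite convex combinations of indices `≥ m`. -/
def convexWeightsFrom (m : ℕ) : Set (ℕ →₀ ℝ) :=
  {a | (∀ n, 0 ≤ a n) ∧ ∑ n ∈ a.support, a n = 1 ∧ ∀ n ∈ a.support, m ≤ n}

theorem convexWeightsFrom_antitone : Antitone convexWeightsFrom :=
  fun _ _ h _ ha => ⟨ha.1, ha.2.1, fun n hn => h.trans (ha.2.2 n hn)⟩

theorem single_mem_convexWeightsFrom (m : ℕ) : Finsupp.single m (1 : ℝ) ∈ convexWeightsFrom m := by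
  refine ⟨fun n => ?_, ?_, fun n hn => ?_⟩
  · rw [Finsupp.single_apply]
    split_ifs <;> norm_num
  · exact Finsupp.sum_single_index (h := fun _ x => x) rfl
  · have := Finsupp.support_single_subset hn
    exact (Finset.mem_singleton.1 this).ge

theorem midpoint_mem_convexWeightsFrom {m : ℕ} {a b : ℕ →₀ ℝ} (ha : a ∈ convexWeightsFrom m)
    (hb : b ∈ convexWeightsFrom m) : (2⁻¹ : ℝ) • (a + b) ∈ convexWeightsFrom m := by
  refine ⟨fun n => ?_, ?_, fun n hn => ?_⟩
  · have := ha.1 n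
    have := hb.1 n
    simp only [Finsupp.smul_apply, Finsupp.add_apply, smul_eq_mul]
    positivity
  · have h (c : ℕ →₀ ℝ) : ∑ n ∈ c.support, c n = Finsupp.linearCombination ℝ (fun _ => (1 : ℝ)) c := by
      simp [Finsupp.linearCombination_apply, Finsupp.sum]
    rw [h, map_smul, map_add, ← h, ← h, ha.2.1, hb.2.1]
    norm_num
  · rcases Finset.mem_union.1 (Finsupp.support_add (Finsupp.support_smul hn)) with h | h
    · exact ha.2.2 n h
    · exact hb.2.2 n h

/-- A bounded sequence in an inner product space has forward convex combinations which form a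
Cauchy sequence. -/
theorem exists_convexWeightsFrom_cauchySeq {H : Type*} [NormedAddCommGroup H]
    [InnerProductSpace ℝ H] {h : ℕ → H} {C : ℝ} (hC : ∀ n, ‖h n‖ ≤ C) :
    ∃ a : ℕ → ℕ →₀ ℝ, (∀ m, a m ∈ convexWeightsFrom m) ∧
      CauchySeq fun m => Finsupp.linearCombination ℝ h (a m) := by
  set F := Finsupp.linearCombination ℝ h
  let S (m : ℕ) : Set ℝ := (fun a => ‖F a‖ ^ 2) '' convexWeightsFrom m
  have hS0 (m) : BddBelow (S m) := ⟨0, by rintro _ ⟨a, -, rfl⟩; positivity⟩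
  have hSn (m) : (S m).Nonempty := ⟨_, _, single_mem_convexWeightsFrom m, rfl⟩
  let q (m : ℕ) : ℝ := sInf (S m)
  have hq_le {m a} (ha : a ∈ convexWeightsFrom m) : q m ≤ ‖F a‖ ^ 2 :=
    csInf_le (hS0 m) ⟨a, ha, rfl⟩
  have hq_mono : Monotone q := fun m n hmn =>
    csInf_le_csInf (hS0 m) (hSn n) (Set.image_mono (convexWeightsFrom_antitone hmn))
  have hq_bdd : BddAbove (Set.range q) := by
    refine ⟨C ^ 2, ?_⟩
    rintro _ ⟨m, rfl⟩
    refine (hq_le (single_mem_convexWeightsFrom m)).trans ?_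
    have : F (Finsupp.single m 1) = h m := by simp [F]
    rw [this]
    exact pow_le_pow_left₀ (norm_nonneg _) (hC m) 2
  have hex (m : ℕ) : ∃ a ∈ convexWeightsFrom m, ‖F a‖ ^ 2 < q m + 1 / ((m : ℝ) + 1) := by
    obtain ⟨_, ⟨a, ha, rfl⟩, hlt⟩ := Real.lt_sInf_add_pos (hSn m)
      (ε := 1 / ((m : ℝ) + 1)) (by positivity)
    exact ⟨a, ha, hlt⟩
  choose a ha hlt using hex
  refine ⟨a, ha, ?_⟩
  -- For `m ≤ n` the midpoint of two near-minimisers is still admissible from `m`, so its squared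
  -- norm is at least `q m`; the parallelogram law then bounds the squared distance by `2 (q n - q
  -- m)` plus errors. As `q` is increasing and bounded, this tends to zero.
  let b (m : ℕ) : ℝ := √(2 * (iSup q - q m) + 4 * (1 / ((m : ℝ) + 1)))
  refine cauchySeq_of_le_tendsto_0' b (fun m n hmn => ?_) ?_
  · refine Real.le_sqrt_of_sq_le ?_
    rw [dist_eq_norm]
    have hpar := parallelogram_law_with_norm ℝ (F (a m)) (F (a n))
    have hmid := hq_le (midpoint_mem_convexWeightsFrom (ha m)
      (convexWeightsFrom_antitone hmn (ha n)))
    rw [map_smul, map_add, norm_smul, mul_pow] at hmid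
    norm_num at hmid
    have hn : q n ≤ iSup q := le_ciSup hq_bdd n
    have hinv : 1 / ((n : ℝ) + 1) ≤ 1 / ((m : ℝ) + 1) := by gcongr
    have h1 := hlt m
    have h2 := hlt n
    nlinarith
  · have h1 : Tendsto (fun m => 2 * (iSup q - q m) + 4 * (1 / ((m : ℝ) + 1))) atTop
        (𝓝 (2 * (iSup q - iSup q) + 4 * 0)) :=
      ((tendsto_const_nhds.sub (tendsto_atTop_ciSup hq_mono hq_bdd)).const_mul 2).add
        (tendsto_one_div_add_atTop_nhds_zero_nat.const_mul 4)
    simpa [b] using h1.sqrt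

/-- A uniformly bounded sequence of measurable functions on a finite measure space has forward
convex combinations which converge almost everywhere. -/
theorem exists_convexWeightsFrom_ae_tendsto {α : Type*} [MeasurableSpace α] {μ : Measure α}
    [IsFiniteMeasure μ] {h : ℕ → α → ℝ} {C : ℝ} (hm : ∀ n, Measurable (h n))
    (hC : ∀ n x, |h n x| ≤ C) :
    ∃ (idx : ℕ → ℕ) (a : ℕ → ℕ →₀ ℝ), Tendsto idx atTop atTop ∧
      (∀ k, a k ∈ convexWeightsFrom (idx k)) ∧
      ∀ᵐ x ∂μ, ∃ l, Tendsto (fun k => ∑ n ∈ (a k).support, a k n * h n x) atTop (𝓝 l) := by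
  have hLp (n) : MemLp (h n) 2 μ :=
    MemLp.of_bound (hm n).aestronglyMeasurable C (.of_forall fun x => hC n x)
  let H (n : ℕ) : Lp ℝ 2 μ := (hLp n).toLp
  obtain ⟨a, ha, hcau⟩ := exists_convexWeightsFrom_cauchySeq (h := H)
    (fun n => Lp.norm_le_of_ae_bound (C := max C 0) (le_max_right _ _) <| by
      filter_upwards [(hLp n).coeFn_toLp] with x hx
      rw [hx]
      exact (hC n x).trans (le_max_left _ _))
  obtain ⟨f, hf⟩ := cauchySeq_tendsto_of_complete hcau
  obtain ⟨idx, hidx, hae⟩ := (tendstoInMeasure_of_tendsto_Lp hf).exists_seq_tendsto_ae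
  refine ⟨idx, fun k => a (idx k), hidx.tendsto_atTop, fun k => ha _, ?_⟩
  have hsum (c : ℕ →₀ ℝ) : ∀ᵐ x ∂μ, (Finsupp.linearCombination ℝ H c : Lp ℝ 2 μ) x =
      ∑ n ∈ c.support, c n * h n x := by
    rw [Finsupp.linearCombination_apply, Finsupp.sum]
    have h1 : ∀ᵐ x ∂μ, ∀ n, (c n • H n : Lp ℝ 2 μ) x = c n * h n x := by
      refine ae_all_iff.2 fun n => ?_
      filter_upwards [Lp.coeFn_smul (c n) (H n), (hLp n).coeFn_toLp] with x h1 h2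
      rw [h1, Pi.smul_apply, h2, smul_eq_mul]
    filter_upwards [Lp.coeFn_finsetSum c.support fun n => c n • H n, h1] with x h2 h3
    rw [h2, Finset.sum_apply]
    exact Finset.sum_congr rfl fun n _ => h3 n
  filter_upwards [hae, ae_all_iff.2 fun k => hsum (a k)] with x hx hs
  exact ⟨f x, by simpa only [hs] using hx⟩

/-- The bounds `A` and `B` keep the real `limsup` from taking a junk value. -/
theorem abs_limsup_sub_limsup_le {a b : ℕ → ℝ} {A B c : ℝ} (ha : ∀ k, |a k| ≤ A)
    (hb : ∀ k, |b k| ≤ B) (hab : ∀ k, |a k - b k| ≤ c) :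
    |limsup a atTop - limsup b atTop| ≤ c := by
  have key {a b : ℕ → ℝ} {A B : ℝ} (ha : ∀ k, |a k| ≤ A) (hb : ∀ k, |b k| ≤ B)
      (hab : ∀ k, a k ≤ b k + c) : limsup a atTop ≤ limsup b atTop + c := by
    have bdd {a : ℕ → ℝ} {A : ℝ} (ha : ∀ k, |a k| ≤ A) : IsBoundedUnder (· ≤ ·) atTop a :=
      isBoundedUnder_of ⟨A, fun k => (abs_le.1 (ha k)).2⟩
    have cobdd {a : ℕ → ℝ} {A : ℝ} (ha : ∀ k, |a k| ≤ A) : IsCoboundedUnder (· ≤ ·) atTop a :=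
      (isBoundedUnder_of (r := (· ≥ ·)) ⟨-A, fun k => (abs_le.1 (ha k)).1⟩).isCoboundedUnder_le
    rw [← limsup_add_const atTop b c (bdd hb) (cobdd hb)]
    refine limsup_le_limsup (.of_forall hab) (cobdd ha) (bdd (A := B + |c|) fun k => ?_)
    exact (abs_add_le _ _).trans (add_le_add_left (hb k) _)
  rw [abs_le]
  have h1 := key ha hb fun k => by linarith [(abs_le.1 (hab k)).2]
  have h2 := key hb ha fun k => by linarith [(abs_le.1 (hab k)).1]
  constructor <;> linarith

/-- The pointwise upper limit of equi-Lipschitz functions vanishing at a common point is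
Lipschitz. -/
theorem lipschitzWith_limsup {X : Type*} [PseudoMetricSpace X] {κ : NNReal} {W : ℕ → X → ℝ}
    {x₀ : X} (hW : ∀ k, LipschitzWith κ (W k)) (h0 : ∀ k, W k x₀ = 0) :
    LipschitzWith κ fun x => limsup (fun k => W k x) atTop := by
  have hb (x k) : |W k x| ≤ κ * dist x x₀ := by
    simpa [Real.dist_eq, h0] using (hW k).dist_le_mul x x₀
  exact .of_dist_le_mul fun x y => abs_limsup_sub_limsup_le (hb x) (hb y)
    fun k => (hW k).dist_le_mul x y

/-- Equi-Lipschitz functions converging on a dense set to a continuous function converge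
everywhere. -/
theorem tendsto_of_tendsto_dense {X : Type*} [PseudoMetricSpace X] {κ : NNReal} {W : ℕ → X → ℝ}
    {f : X → ℝ} (hW : ∀ k, LipschitzWith κ (W k)) (hf : Continuous f) {s : Set X} (hs : Dense s)
    (h : ∀ x ∈ s, Tendsto (W · x) atTop (𝓝 (f x))) (x : X) :
    Tendsto (W · x) atTop (𝓝 (f x)) :=
  (LipschitzWith.uniformEquicontinuous W κ hW).equicontinuous.isClosed_setOfPred_tendsto hf
    |>.closure_subset_iff.2 h (hs x)

/-- Equi-Lipschitz functions converging pointwise converge uniformly on compact sets. -/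
theorem tendstoUniformlyOn_of_tendsto {X : Type*} [PseudoMetricSpace X] {κ : NNReal}
    {W : ℕ → X → ℝ} {f : X → ℝ} (hW : ∀ k, LipschitzWith κ (W k))
    (h : ∀ x, Tendsto (W · x) atTop (𝓝 (f x))) {K : Set X} (hK : IsCompact K) :
    TendstoUniformlyOn W f atTop K := by
  have heq := (LipschitzWith.uniformEquicontinuous W κ hW).equicontinuous
  refine UniformOnFun.tendsto_iff_tendstoUniformlyOn.1
    ((EquicontinuousOn.tendsto_uniformOnFun_iff_pi' (𝔖 := {K}) (by simpa using hK)
      (fun K _ => heq.equicontinuousOn K) atTop f).2 ?_) K rfl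
  exact tendsto_pi_nhds.2 fun x => h x

theorem lipschitzWith_convex_comb {X : Type*} [PseudoMetricSpace X] {κ : NNReal} {f : ℕ → X → ℝ}
    (hf : ∀ n, LipschitzWith κ (f n)) {m : ℕ} {a : ℕ →₀ ℝ} (ha : a ∈ convexWeightsFrom m) (c : ℝ) :
    LipschitzWith κ fun x => (∑ n ∈ a.support, a n * f n x) + c := by
  refine .of_dist_le_mul fun x y => ?_
  rw [dist_add_right, Real.dist_eq, ← Finset.sum_sub_distrib]
  calc |∑ n ∈ a.support, (a n * f n x - a n * f n y)|
      ≤ ∑ n ∈ a.support, |a n * f n x - a n * f n y| := Finset.abs_sum_le_sum_abs _ _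
    _ ≤ ∑ n ∈ a.support, a n * (κ * dist x y) := Finset.sum_le_sum fun n _ => by
        rw [← mul_sub, abs_mul, abs_of_nonneg (ha.1 n)]
        exact mul_le_mul_of_nonneg_left ((hf n).dist_le_mul x y) (ha.1 n)
    _ = κ * dist x y := by rw [← Finset.sum_mul, ha.2.1, one_mul]

theorem measurable_eval_of_measurable_borel {X Ω : Type*} [TopologicalSpace X] [MeasurableSpace Ω]
    {v : Ω → C(X, ℝ)} (hv : Measurable[_, borel C(X, ℝ)] v) (x : X) :
    Measurable fun ω => v ω x := by
  borelize C(X, ℝ)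
  exact (continuous_eval_const x).measurable.comp hv

/-- Random equi-Lipschitz functions have forward convex combinations which, normalised at the
origin, almost surely converge at every point of a given sequence. -/
theorem exists_convexWeightsFrom_ae_tendsto_seq {E Ω : Type*} [SeminormedAddCommGroup E]
    [MeasurableSpace Ω] (P : Measure Ω) [IsFiniteMeasure P] {κ : NNReal} {v : ℕ → Ω → C(E, ℝ)}
    (hm : ∀ n x, Measurable fun ω => v n ω x) (hv : ∀ n ω, LipschitzWith κ (v n ω)) (d : ℕ → E) :
    ∃ (idx : ℕ → ℕ) (a : ℕ → ℕ →₀ ℝ), Tendsto idx atTop atTop ∧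
      (∀ k, a k ∈ convexWeightsFrom (idx k)) ∧
      ∀ᵐ ω ∂P, ∀ i, ∃ l, Tendsto
        (fun k => (∑ n ∈ (a k).support, a k n * v n ω (d i)) +
          -∑ n ∈ (a k).support, a k n * v n ω 0) atTop (𝓝 l) := by
  -- A finite measure with the null sets of counting measure: a.e. on the product means, for a.e.
  -- `ω`, at every index.
  let ν : Measure ℕ := Measure.count.toFinite
  -- The weight turns linear growth into the uniform bound `κ`.
  let h (n : ℕ) (p : Ω × ℕ) : ℝ := (1 + ‖d p.2‖)⁻¹ * (v n p.1 (d p.2) - v n p.1 0)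
  have hmeas (n) : Measurable (h n) := measurable_from_prod_countable_left fun i =>
    ((hm n (d i)).sub (hm n 0)).const_mul (1 + ‖d i‖)⁻¹
  have hbd (n p) : |h n p| ≤ κ := by
    have h1 : |v n p.1 (d p.2) - v n p.1 0| ≤ κ * ‖d p.2‖ := by
      simpa [Real.dist_eq] using (hv n p.1).dist_le_mul (d p.2) 0
    have h2 : 0 < 1 + ‖d p.2‖ := by positivity
    rw [abs_mul, abs_of_pos (inv_pos.2 h2), inv_mul_le_iff₀ h2]
    nlinarith [κ.coe_nonneg]
  obtain ⟨idx, a, hidx, ha, hae⟩ :=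
    exists_convexWeightsFrom_ae_tendsto (μ := P.prod ν) hmeas hbd
  refine ⟨idx, a, hidx, ha, ?_⟩
  filter_upwards [Measure.ae_ae_of_ae_prod hae] with ω hω i
  rw [ae_toFinite, Measure.ae_count_iff] at hω
  obtain ⟨l, hl⟩ := hω i
  refine ⟨(1 + ‖d i‖) * l, (hl.const_mul (1 + ‖d i‖)).congr fun k => ?_⟩
  have h2 : 1 + ‖d i‖ ≠ 0 := by positivity
  rw [← sub_eq_add_neg, ← Finset.sum_sub_distrib, Finset.mul_sum]
  refine Finset.sum_congr rfl fun n _ => ?_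
  simp only [h]
  field_simp

theorem mainTheorem9 {N : ℕ} {Ω : Type*} [MeasurableSpace Ω] (P : Measure Ω)
    [IsProbabilityMeasure P] (τ : EuclideanSpace ℝ (Fin N) → Ω → Ω)
    (hτ : IsDynamicalSystem P τ)
    (v : ℕ → Ω → C(EuclideanSpace ℝ (Fin N), ℝ))
    (hv : ∃ κ : NNReal, 0 < κ ∧ ∀ n, IsLipschitzRandomFunctionWith κ (v n))
    (hinc : ∀ n, HasStationaryIncrements P τ (v n)) :
    ∃ (u : Ω → C(EuclideanSpace ℝ (Fin N), ℝ)) (idx : ℕ → ℕ) (lam : ℕ → ℕ →₀ ℝ)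
      (g : ℕ → Ω → ℝ),
      IsLipschitzRandomFunction u ∧
      HasStationaryIncrements P τ u ∧
      Tendsto idx atTop atTop ∧
      (∀ k, (∀ n, 0 ≤ lam k n) ∧ (∑ n ∈ (lam k).support, lam k n) = 1 ∧
        ∀ n ∈ (lam k).support, idx k ≤ n) ∧
      (∀ k, Measurable (g k)) ∧
      ∀ᵐ ω ∂P, ∀ K : Set (EuclideanSpace ℝ (Fin N)), IsCompact K →
        TendstoUniformlyOn
          (fun k x => (∑ n ∈ (lam k).support, lam k n * v n ω x) + g k ω)
          (fun x => u ω x) atTop K := by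
  obtain ⟨κ, hκ, hv⟩ := hv
  have hm (n x) : Measurable fun ω => v n ω x := measurable_eval_of_measurable_borel (hv n).1 x
  obtain ⟨idx, a, hidx, ha, hae⟩ := exists_convexWeightsFrom_ae_tendsto_seq P hm
    (fun n ω => (hv n).2 ω) (TopologicalSpace.denseSeq (EuclideanSpace ℝ (Fin N)))
  let g (k : ℕ) (ω : Ω) : ℝ := -∑ n ∈ (a k).support, a k n * v n ω 0
  let W (k : ℕ) (ω : Ω) (x : EuclideanSpace ℝ (Fin N)) : ℝ :=
    (∑ n ∈ (a k).support, a k n * v n ω x) + g k ω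
  have hg (k) : Measurable (g k) :=
    (Finset.measurable_fun_sum _ fun n _ => (hm n 0).const_mul (a k n)).neg
  have hWm (k x) : Measurable fun ω => W k ω x :=
    (Finset.measurable_fun_sum _ fun n _ => (hm n x).const_mul (a k n)).add (hg k)
  have hWL (k ω) : LipschitzWith κ (W k ω) :=
    lipschitzWith_convex_comb (fun n => (hv n).2 ω) (ha k) _
  have hW0 (k ω) : W k ω 0 = 0 := add_neg_cancel _
  have hL (ω) : LipschitzWith κ fun x => limsup (fun k => W k ω x) atTop :=
    lipschitzWith_limsup (fun k => hWL k ω) fun k => hW0 k ω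
  -- An upper limit is Lipschitz for every `ω` and measurable, with no exceptional null set to
  -- repair.
  let u (ω : Ω) : C(EuclideanSpace ℝ (Fin N), ℝ) :=
    ⟨fun x => limsup (fun k => W k ω x) atTop, (hL ω).continuous⟩
  have hlim : ∀ᵐ ω ∂P, ∀ x, Tendsto (fun k => W k ω x) atTop (𝓝 (u ω x)) := by
    filter_upwards [hae] with ω hω
    refine tendsto_of_tendsto_dense (fun k => hWL k ω) (u ω).continuous
      (TopologicalSpace.denseRange_denseSeq _) ?_
    rintro _ ⟨i, rfl⟩
    obtain ⟨l, hl⟩ := hω i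
    have : u ω (TopologicalSpace.denseSeq _ i) = l := hl.limsup_eq
    rwa [this]
  refine ⟨u, idx, a, g, ⟨κ, hκ, measurable_borel_continuousMap_of_eval fun x => ?_, hL⟩,
    fun z => ?_, hidx, ha, hg, ?_⟩
  · exact Measurable.limsup fun k => hWm k x
  -- Since `τ z` preserves `P`, convergence also holds at `τ z ω` almost surely; `g k` cancels in
  -- each increment.
  · filter_upwards [hlim, (hτ.measurePreserving z).quasiMeasurePreserving.ae hlim,
      ae_all_iff.2 fun n => hinc n z] with ω h1 h2 h3 x y
    refine tendsto_nhds_unique ((h1 (x + z)).sub (h1 (y + z)))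
      (((h2 x).sub (h2 y)).congr fun k => ?_)
    simp only [W, add_sub_add_right_eq_sub, ← Finset.sum_sub_distrib, ← mul_sub, h3]
  · filter_upwards [hlim] with ω hω K hK
    exact tendstoUniformlyOn_of_tendsto (fun k => hWL k ω) hω hK
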